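/- Let $\alpha\in\mathbb N_0=\{0,1,2,\dots\}$ and $D=d/dx$. For $\lambda\ge 0$, $M\ge 0$ and $0\le x<\infty$ put $$J_\lambda^{\alpha}(x)={}_0F_1\!\big(-;\alpha+1;-\tfrac14(\lambda x)^2\big)=\sum_{k=0}^\infty\frac{\big(-\tfrac14(\lambda x)^2\big)^k}{(\alpha+1)_k\,k!},\qquad K_\lambda^{\alpha}(x)=-\frac{(\lambda/2)^{2\alpha+4}}{(\alpha+1)\,(\alpha+2)!}\,x^2J_\lambda^{\alpha+2}(x),$$ where $(b)_k=b(b+1)\cdots(b+k-1)$, and define the Bessel-type functions by $J_\lambda^{\alpha,M}=J_\lambda^{\alpha}+M\,K_\lambda^{\alpha}$. For real-valued functions $y$ and $x>0$ put $$\widetilde L_{2}^{\alpha}y(x)=x^{-2\alpha-1}D\big[x^{2\alpha+1}Dy(x)\big],\qquad \widetilde L_{2\alpha+4}^{\alpha}y(x)=(-1)^{\alpha+1}x^2\,(x^{-1}D)^{2\alpha+4}\big[x^{2\alpha+2}y(x)\big].$$ **Theorem 5.1.** (i) The two operators have the alternative representations $$\widetilde L_{2}^{\alpha}y(x)=\Big[D^2+\frac{2\alpha+1}{x}D\Big]y(x)\quad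 (y\in C^{2}(0,\infty),\ x>0),$$ $$\widetilde L_{2\alpha+4}^{\alpha}y(x)=(-1)^{\alpha+1}\Big[D^2+\frac{2\alpha+1}{x}D-\frac{4\alpha+4}{x^2}\Big]^{\alpha+2}y(x)\quad (y\in C^{2\alpha+4}(0,\infty),\ x>0).$$ For all $M\ge 0$ and $\lambda\ge 0$, the function $y=J_\lambda^{\alpha,M}$ is infinitely differentiable on $[0,\infty)$ and satisfies $$\Big\{\big[\widetilde L_{2}^{\alpha}+\lambda^2\big]+\frac{M}{2^{2\alpha+2}(\alpha+2)!}\big[\widetilde L_{2\alpha+4}^{\alpha}+\lambda^{2\alpha+4}\big]\Big\}\,y(x)=0,\qquad 0\le x<\infty .$$ (ii) For all $\lambda\ge 0$, the function $K_\lambda^{\alpha}$ is infinitely differentiable on $[0,\infty)$ and satisfies $$\big[\widetilde L_{2\alpha+4}^{\alpha}+\lambda^{2\alpha+4}\big]K_\lambda^{\alpha}(x)=0,\qquad 0\le x<\infty .$$ If $\lambda>0$, then $K_\lambda^{\alpha}$ does not vanish identically on $(0,\infty)$, so it is an eigenfunction of $\widetilde L_{2\alpha+4}^{\alpha}$ with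 eigenvalue $-\lambda^{2\alpha+4}$. In both equations, the values at $x=0$ of $\widetilde L_{2}^{\alpha}y$ and $\widetilde L_{2\alpha+4}^{\alpha}y$ are the limits as $x\to0^+$; the existence of these limits is part of the assertion. -/

import Mathlib

open Set Filter Topology
open scoped ContDiff

noncomputable section

/-- The hypergeometric series `₀F₁(-; b; z) = ∑ₖ z ^ k / ((b)ₖ k!)`, where `(b)ₖ` is the
rising factorial. It converges for every `z` if `b` is not a nonpositive integer. -/
def hypergeometricZeroFOne (b z : ℝ) : ℝ :=
  ∑' k : ℕ, z ^ k / ((ascPochhammer ℝ k).eval b * (Nat.factorial k : ℝ))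

/-- The normalized classical Bessel function `J_lam^α(x) = ₀F₁(-; α + 1; -(lam x)² / 4)`. -/
def besselJ (α : ℕ) (lam x : ℝ) : ℝ :=
  hypergeometricZeroFOne ((α : ℝ) + 1) (-(1 / 4) * (lam * x) ^ 2)

/-- `k_lam^α = (lam / 2) ^ (2 α + 4) / ((α + 1) (α + 2)!)`. -/
def besselCoeff (α : ℕ) (lam : ℝ) : ℝ :=
  (lam / 2) ^ (2 * α + 4) / (((α : ℝ) + 1) * (Nat.factorial (α + 2) : ℝ))

/-- The second component `K_lam^α(x) = - k_lam^α x² J_lam^(α+2)(x)`. -/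
def besselK (α : ℕ) (lam x : ℝ) : ℝ :=
  -besselCoeff α lam * x ^ 2 * besselJ (α + 2) lam x

/-- The Bessel-type function `J_lam^(α,M) = J_lam^α + M K_lam^α`. -/
def besselTypeJ (α : ℕ) (M lam x : ℝ) : ℝ :=
  besselJ α lam x + M * besselK α lam x

/-- The operator `y ↦ x⁻¹ D y`. -/
def invXDeriv (y : ℝ → ℝ) : ℝ → ℝ := fun x => x⁻¹ * deriv y x

/-- The Bessel operator `y ↦ x ^ (-2 α - 1) D [x ^ (2 α + 1) D y]`. -/
def besselOpTwo (α : ℕ) (y : ℝ → ℝ) : ℝ → ℝ := fun x =>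
  (x ^ (2 * α + 1))⁻¹ * deriv (fun t => t ^ (2 * α + 1) * deriv y t) x

/-- The operator `y ↦ (-1) ^ (α + 1) x² (x⁻¹ D) ^ (2 α + 4) [x ^ (2 α + 2) y]`
of order `2 α + 4`. -/
def besselOpHigher (α : ℕ) (y : ℝ → ℝ) : ℝ → ℝ := fun x =>
  (-1) ^ (α + 1) * x ^ 2 * (invXDeriv^[2 * α + 4] (fun t => t ^ (2 * α + 2) * y t)) x

/-- The second-order factor `y ↦ [D² + ((2 α + 1) / x) D - (4 α + 4) / x²] y`. -/
def besselFactor (α : ℕ) (y : ℝ → ℝ) : ℝ → ℝ := fun x =>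
  deriv (deriv y) x + (2 * (α : ℝ) + 1) / x * deriv y x - (4 * (α : ℝ) + 4) / x ^ 2 * y x

end

/-! Write `δ = x⁻¹ D`, `Lₘ = besselOpTwo m` and `H = besselOpHigher α`. From
`Lₘ = x² δ² + (2 m + 2) δ` one gets `L_{m+1} δ = δ Lₘ` and `L_{m+1} = δ x^{-2m} δ x^{2m+2}`, and
these two identities collapse `Lₘ^m` to `δ^{2m} x^{2m}`. Since `x² L_{α+2} x⁻²` is the factor
`D² + ((2 α + 1) / x) D - (4 α + 4) / x²`, the case `m = α + 2` is the factorization of `H`.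

The functions `jₙ = (lam x)⁻ⁿ Jₙ(lam x)` satisfy `δ jₙ = -lam² jₙ₊₁` and
`δ (x^{2n+2} jₙ₊₁) = x^{2n} jₙ`, so `δ^{n+k} (x^{2n} jₙ) = (-lam²)^k j_k`. This evaluates both
operators on `J_lam^α` and `K_lam^α`: they are eigenfunctions of one operator each, and the defects
`(H + lam^{2α+4}) J_lam^α = lam^{2α+4} J_lam^{α+2}` and
`(L_α + lam²) K_lam^α = -lam^{2α+4} / (2^{2α+2} (α+2)!) J_lam^{α+2}` cancel in the combined equation.
-/

theorem eventually_of_ne_of_contDiffAt {p : ℝ → Prop} {f : ℝ → ℝ} {n : ℕ} {x : ℝ} (hx : x ≠ 0)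
    (hf : ContDiffAt ℝ n f x) (h : ∀ t, t ≠ 0 → ContDiffAt ℝ n f t → p t) : ∀ᶠ t in 𝓝 x, p t := by
  filter_upwards [isOpen_ne.eventually_mem hx, hf.eventually (by simp)] with t ht hft
  exact h t ht hft

theorem contDiffAt_natCast {f : ℝ → ℝ} {x : ℝ} (n : ℕ) (hf : ContDiff ℝ ∞ f) :
    ContDiffAt ℝ n f x :=
  (contDiff_infty.mp hf n).contDiffAt

theorem contDiffAt_pow_mul {f : ℝ → ℝ} {n : WithTop ℕ∞} {x : ℝ} (m : ℕ)
    (hf : ContDiffAt ℝ n f x) : ContDiffAt ℝ n (fun t => t ^ m * f t) x :=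
  (contDiffAt_id.pow m).mul hf

theorem contDiffAt_inv_pow_mul {f : ℝ → ℝ} {n : WithTop ℕ∞} {x : ℝ} (m : ℕ) (hx : x ≠ 0)
    (hf : ContDiffAt ℝ n f x) : ContDiffAt ℝ n (fun t => (t ^ m)⁻¹ * f t) x :=
  ((contDiffAt_id.pow m).inv (pow_ne_zero m hx)).mul hf

section InvXDeriv

variable {f g : ℝ → ℝ} {x : ℝ} {k n : ℕ}

theorem invXDeriv_congr (h : f =ᶠ[𝓝 x] g) : invXDeriv f =ᶠ[𝓝 x] invXDeriv g := by
  filter_upwards [h.deriv] with t ht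
  rw [invXDeriv, invXDeriv, ht]

theorem invXDeriv_iterate_congr (h : f =ᶠ[𝓝 x] g) (j : ℕ) :
    invXDeriv^[j] f =ᶠ[𝓝 x] invXDeriv^[j] g := by
  induction j generalizing f g with
  | zero => exact h
  | succ _ ih => exact ih (invXDeriv_congr h)

theorem deriv_eq_mul_invXDeriv (f : ℝ → ℝ) (hx : x ≠ 0) : deriv f x = x * invXDeriv f x := by
  rw [invXDeriv, mul_inv_cancel_left₀ hx]

theorem contDiffAt_invXDeriv (hx : x ≠ 0) (hf : ContDiffAt ℝ (n + 1 : ℕ) f x) :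
    ContDiffAt ℝ n (invXDeriv f) x :=
  (contDiffAt_inv ℝ hx).mul (hf.derivWithin (by norm_cast))

theorem contDiffAt_invXDeriv_iterate (hx : x ≠ 0) (hf : ContDiffAt ℝ (n + k : ℕ) f x) :
    ContDiffAt ℝ n (invXDeriv^[k] f) x := by
  induction k generalizing f with
  | zero => exact hf
  | succ k ih => exact ih (contDiffAt_invXDeriv hx hf)

theorem invXDeriv_iterate_const_mul (c : ℝ) (f : ℝ → ℝ) (j : ℕ) :
    invXDeriv^[j] (fun t => c * f t) = fun t => c * invXDeriv^[j] f t := by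
  induction j generalizing f with
  | zero => rfl
  | succ j ih =>
    have h : (invXDeriv fun t => c * f t) = fun t => c * invXDeriv f t := by
      ext t
      rw [invXDeriv, invXDeriv, deriv_const_mul_field, mul_left_comm]
    simp only [Function.iterate_succ_apply, h, ih]

theorem invXDeriv_iterate_add (hx : x ≠ 0) (hf : ContDiffAt ℝ k f x) (hg : ContDiffAt ℝ k g x) :
    invXDeriv^[k] (fun t => f t + g t) x = invXDeriv^[k] f x + invXDeriv^[k] g x := by
  induction k generalizing f g with
  | zero => rfl
  | succ k ih =>
    have h : (invXDeriv fun t => f t + g t) =ᶠ[𝓝 x] fun t => invXDeriv f t + invXDeriv g t := by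
      filter_upwards [hf.eventually (by simp), hg.eventually (by simp)] with t hft hgt
      rw [invXDeriv, deriv_fun_add (hft.differentiableAt (by simp))
        (hgt.differentiableAt (by simp)), mul_add, invXDeriv, invXDeriv]
    simp only [Function.iterate_succ_apply, (invXDeriv_iterate_congr h k).eq_of_nhds]
    exact ih (contDiffAt_invXDeriv hx hf) (contDiffAt_invXDeriv hx hg)

theorem invXDeriv_pow_mul (n : ℕ) (hx : x ≠ 0) (hf : DifferentiableAt ℝ f x) :
    invXDeriv (fun t => t ^ (2 * n + 2) * f t) x =
      x ^ (2 * n) * (x ^ 2 * invXDeriv f x + (2 * n + 2) * f x) := by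
  rw [invXDeriv, ((hasDerivAt_pow (2 * n + 2) x).fun_mul hf.hasDerivAt).deriv,
    deriv_eq_mul_invXDeriv f hx, show 2 * n + 2 - 1 = 2 * n + 1 by lia]
  push_cast
  field_simp
  ring

theorem invXDeriv_sq_mul_add_const_mul (c : ℝ) (hx : x ≠ 0) (hf : DifferentiableAt ℝ f x)
    (hg : DifferentiableAt ℝ g x) :
    invXDeriv (fun t => t ^ 2 * f t + c * g t) x =
      x ^ 2 * invXDeriv f x + 2 * f x + c * invXDeriv g x := by
  rw [invXDeriv, (((hasDerivAt_pow 2 x).fun_mul hf.hasDerivAt).fun_add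
    (hg.hasDerivAt.const_mul c)).deriv, deriv_eq_mul_invXDeriv f hx, deriv_eq_mul_invXDeriv g hx]
  push_cast
  field_simp
  ring

end InvXDeriv

section BesselOpTwo

variable {f g : ℝ → ℝ} {x : ℝ} {k n : ℕ}

theorem besselOpTwo_congr (m : ℕ) (h : f =ᶠ[𝓝 x] g) : besselOpTwo m f =ᶠ[𝓝 x] besselOpTwo m g := by
  have h' : (fun t => t ^ (2 * m + 1) * deriv f t) =ᶠ[𝓝 x] fun t => t ^ (2 * m + 1) * deriv g t :=
    h.deriv.mono fun t ht => by simp only [ht]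
  filter_upwards [h'.deriv] with t ht
  rw [besselOpTwo, besselOpTwo, ht]

theorem besselOpTwo_eq_deriv (m : ℕ) (hx : x ≠ 0) (hf : ContDiffAt ℝ 2 f x) :
    besselOpTwo m f x = deriv (deriv f) x + (2 * m + 1) / x * deriv f x := by
  have hf' : DifferentiableAt ℝ (deriv f) x :=
    (hf.derivWithin (m := 1) (by norm_num)).differentiableAt one_ne_zero
  rw [besselOpTwo, ((hasDerivAt_pow (2 * m + 1) x).fun_mul hf'.hasDerivAt).deriv,
    Nat.add_sub_cancel]
  push_cast
  field_simp
  ring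

theorem besselOpTwo_eq_invXDeriv (m : ℕ) (hx : x ≠ 0) (hf : ContDiffAt ℝ 2 f x) :
    besselOpTwo m f x = x ^ 2 * invXDeriv (invXDeriv f) x + (2 * m + 2) * invXDeriv f x := by
  have hδf : DifferentiableAt ℝ (invXDeriv f) x :=
    (contDiffAt_invXDeriv (n := 1) hx hf).differentiableAt one_ne_zero
  have hderiv : deriv f =ᶠ[𝓝 x] fun t => t * invXDeriv f t :=
    (isOpen_ne.eventually_mem hx).mono fun t ht => deriv_eq_mul_invXDeriv f ht
  rw [besselOpTwo_eq_deriv m hx hf, hderiv.deriv_eq, hderiv.eq_of_nhds,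
    ((hasDerivAt_id' x).fun_mul hδf.hasDerivAt).deriv, deriv_eq_mul_invXDeriv _ hx]
  field_simp
  ring

theorem contDiffAt_besselOpTwo (m : ℕ) (hx : x ≠ 0) (hf : ContDiffAt ℝ (n + 2 : ℕ) f x) :
    ContDiffAt ℝ n (besselOpTwo m f) x := by
  have hf' : ContDiffAt ℝ (n + 1 : ℕ) (deriv f) x := hf.derivWithin (by norm_cast)
  exact contDiffAt_inv_pow_mul _ hx ((contDiffAt_pow_mul _ hf').derivWithin (by norm_cast))

theorem contDiffAt_besselOpTwo_iterate (m : ℕ) (hx : x ≠ 0)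
    (hf : ContDiffAt ℝ (n + 2 * k : ℕ) f x) : ContDiffAt ℝ n ((besselOpTwo m)^[k] f) x := by
  induction k generalizing f with
  | zero => exact hf
  | succ k ih => exact ih (contDiffAt_besselOpTwo m hx hf)

theorem besselOpTwo_const_mul (m : ℕ) (c : ℝ) (f : ℝ → ℝ) (x : ℝ) :
    besselOpTwo m (fun t => c * f t) x = c * besselOpTwo m f x := by
  simp only [besselOpTwo, deriv_const_mul_field, mul_left_comm _ c]

theorem besselOpTwo_add (m : ℕ) (hx : x ≠ 0) (hf : ContDiffAt ℝ 2 f x) (hg : ContDiffAt ℝ 2 g x) :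
    besselOpTwo m (fun t => f t + g t) x = besselOpTwo m f x + besselOpTwo m g x := by
  have h₁ := invXDeriv_iterate_add (k := 1) hx (hf.of_le one_le_two) (hg.of_le one_le_two)
  have h₂ := invXDeriv_iterate_add (k := 2) hx hf hg
  simp only [Function.iterate_succ_apply, Function.iterate_zero_apply] at h₁ h₂
  rw [besselOpTwo_eq_invXDeriv m hx hf, besselOpTwo_eq_invXDeriv m hx hg,
    besselOpTwo_eq_invXDeriv m hx (hf.add hg), h₁, h₂]
  ring

theorem besselOpTwo_sq_mul (m : ℕ) (hx : x ≠ 0) (hf : ContDiffAt ℝ 2 f x) :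
    besselOpTwo m (fun t => t ^ 2 * f t) x =
      x ^ 2 * besselOpTwo (m + 2) f x + 4 * (m + 1) * f x := by
  have hδ : (invXDeriv fun t => t ^ 2 * f t) =ᶠ[𝓝 x] fun t => t ^ 2 * invXDeriv f t + 2 * f t :=
    eventually_of_ne_of_contDiffAt hx hf fun t ht hft => by
      simpa using invXDeriv_pow_mul 0 ht (hft.differentiableAt two_ne_zero)
  have hδδ := invXDeriv_sq_mul_add_const_mul 2 hx
    ((contDiffAt_invXDeriv (n := 1) hx hf).differentiableAt one_ne_zero)
    (hf.differentiableAt two_ne_zero)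
  rw [besselOpTwo_eq_invXDeriv m hx (contDiffAt_pow_mul 2 hf),
    (invXDeriv_congr hδ).eq_of_nhds, hδ.eq_of_nhds, hδδ, besselOpTwo_eq_invXDeriv _ hx hf]
  push_cast
  ring

theorem besselOpTwo_succ_invXDeriv (m : ℕ) (hx : x ≠ 0) (hf : ContDiffAt ℝ 3 f x) :
    besselOpTwo (m + 1) (invXDeriv f) x = invXDeriv (besselOpTwo m f) x := by
  have hδf : ContDiffAt ℝ 2 (invXDeriv f) x := contDiffAt_invXDeriv (n := 2) hx hf
  have hL : besselOpTwo m f =ᶠ[𝓝 x]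
      fun t => t ^ 2 * invXDeriv (invXDeriv f) t + (2 * m + 2) * invXDeriv f t :=
    eventually_of_ne_of_contDiffAt (n := 3) hx hf fun t ht hft =>
      besselOpTwo_eq_invXDeriv m ht (hft.of_le (by norm_num))
  rw [(invXDeriv_congr hL).eq_of_nhds, besselOpTwo_eq_invXDeriv _ hx hδf,
    invXDeriv_sq_mul_add_const_mul _ hx
      ((contDiffAt_invXDeriv (n := 1) hx hδf).differentiableAt one_ne_zero)
      (hδf.differentiableAt two_ne_zero)]
  push_cast
  ring

theorem besselOpTwo_add_invXDeriv_iterate (m : ℕ) (hx : x ≠ 0)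
    (hf : ContDiffAt ℝ (k + 2 : ℕ) f x) :
    besselOpTwo (m + k) (invXDeriv^[k] f) x = invXDeriv^[k] (besselOpTwo m f) x := by
  induction k generalizing f m with
  | zero => rfl
  | succ k ih =>
    have hL : besselOpTwo (m + 1) (invXDeriv f) =ᶠ[𝓝 x] invXDeriv (besselOpTwo m f) :=
      eventually_of_ne_of_contDiffAt hx hf fun t ht hft =>
        besselOpTwo_succ_invXDeriv m ht (hft.of_le (by norm_cast; lia))
    rw [Function.iterate_succ_apply, Function.iterate_succ_apply,
      ← (invXDeriv_iterate_congr hL k).eq_of_nhds, ← ih (m + 1) (contDiffAt_invXDeriv hx hf),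
      add_right_comm, add_assoc]

theorem besselOpTwo_succ_eq_invXDeriv_comp (m : ℕ) (hx : x ≠ 0) (hf : ContDiffAt ℝ 2 f x) :
    besselOpTwo (m + 1) f x =
      invXDeriv (fun t => (t ^ (2 * m))⁻¹ * invXDeriv (fun s => s ^ (2 * m + 2) * f s) t) x := by
  have hδ : (fun t => (t ^ (2 * m))⁻¹ * invXDeriv (fun s => s ^ (2 * m + 2) * f s) t) =ᶠ[𝓝 x]
      fun t => t ^ 2 * invXDeriv f t + (2 * m + 2) * f t :=
    eventually_of_ne_of_contDiffAt (n := 2) hx hf fun t ht hft => by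
      beta_reduce
      rw [invXDeriv_pow_mul m ht (hft.differentiableAt two_ne_zero),
        inv_mul_cancel_left₀ (pow_ne_zero _ ht)]
  rw [(invXDeriv_congr hδ).eq_of_nhds, besselOpTwo_eq_invXDeriv _ hx hf,
    invXDeriv_sq_mul_add_const_mul _ hx
      ((contDiffAt_invXDeriv (n := 1) hx hf).differentiableAt one_ne_zero)
      (hf.differentiableAt two_ne_zero)]
  push_cast
  ring

theorem besselOpTwo_add_iterate (j : ℕ) (hx : x ≠ 0) (hf : ContDiffAt ℝ (2 * k : ℕ) f x) :
    (besselOpTwo (j + k))^[k] f x =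
      invXDeriv^[k] (fun t => (t ^ (2 * j))⁻¹ *
        invXDeriv^[k] (fun s => s ^ (2 * (j + k)) * f s) t) x := by
  induction k generalizing j x with
  | zero => simp [hx]
  | succ k ih =>
    rw [← add_assoc, add_right_comm]
    set W : ℝ → ℝ := invXDeriv^[k] fun s => s ^ (2 * (j + 1 + k)) * f s
    set U : ℝ → ℝ := fun t => (t ^ (2 * (j + 1)))⁻¹ * W t
    have hUsmooth : ContDiffAt ℝ (k + 2 : ℕ) U x :=
      contDiffAt_inv_pow_mul _ hx <| contDiffAt_invXDeriv_iterate hx <|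
        contDiffAt_pow_mul _ (hf.of_le (by norm_cast; lia))
    have hW {t : ℝ} (ht : t ≠ 0) : (fun s => s ^ (2 * j + 2) * U s) =ᶠ[𝓝 t] W :=
      (isOpen_ne.eventually_mem ht).mono fun s hs => mul_inv_cancel_left₀ (pow_ne_zero _ hs) _
    calc (besselOpTwo (j + 1 + k))^[k + 1] f x
        = besselOpTwo (j + 1 + k) (invXDeriv^[k] U) x := by
          rw [Function.iterate_succ_apply']
          refine (besselOpTwo_congr _ ?_).eq_of_nhds
          exact eventually_of_ne_of_contDiffAt hx hf fun t ht hft =>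
            ih (j + 1) ht (hft.of_le (by norm_cast; lia))
      _ = invXDeriv^[k] (besselOpTwo (j + 1) U) x :=
          besselOpTwo_add_invXDeriv_iterate (j + 1) hx hUsmooth
      _ = invXDeriv^[k] (invXDeriv fun t => (t ^ (2 * j))⁻¹ * invXDeriv W t) x := by
          refine (invXDeriv_iterate_congr ?_ k).eq_of_nhds
          refine eventually_of_ne_of_contDiffAt hx hUsmooth fun t ht hUt => ?_
          rw [besselOpTwo_succ_eq_invXDeriv_comp j ht (hUt.of_le (by norm_cast; lia))]
          refine (invXDeriv_congr ?_).eq_of_nhds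
          filter_upwards [isOpen_ne.eventually_mem ht] with s hs
          rw [(invXDeriv_congr (hW hs)).eq_of_nhds]
      _ = _ := by rw [← Function.iterate_succ_apply' invXDeriv, ← Function.iterate_succ_apply]

theorem besselOpTwo_iterate_self (m : ℕ) (hx : x ≠ 0) (hf : ContDiffAt ℝ (2 * m : ℕ) f x) :
    (besselOpTwo m)^[m] f x = invXDeriv^[2 * m] (fun t => t ^ (2 * m) * f t) x := by
  have h := besselOpTwo_add_iterate 0 hx hf
  simpa only [zero_add, mul_zero, pow_zero, inv_one, one_mul, two_mul m,
    Function.iterate_add_apply] using h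

end BesselOpTwo

section HigherOrder

variable {f g : ℝ → ℝ} {x : ℝ}

theorem besselFactor_congr (α : ℕ) (h : f =ᶠ[𝓝 x] g) :
    besselFactor α f =ᶠ[𝓝 x] besselFactor α g := by
  filter_upwards [h, h.deriv, h.deriv.deriv] with t h₀ h₁ h₂
  rw [besselFactor, besselFactor, h₀, h₁, h₂]

theorem besselFactor_sq_mul (α : ℕ) (hx : x ≠ 0) (hf : ContDiffAt ℝ 2 f x) :
    besselFactor α (fun t => t ^ 2 * f t) x = x ^ 2 * besselOpTwo (α + 2) f x := by
  rw [besselFactor, ← besselOpTwo_eq_deriv α hx (contDiffAt_pow_mul 2 hf),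
    besselOpTwo_sq_mul α hx hf]
  field_simp
  ring

theorem besselFactor_iterate (α n : ℕ) (hx : x ≠ 0) (hf : ContDiffAt ℝ (2 * n : ℕ) f x) :
    (besselFactor α)^[n] f x =
      x ^ 2 * (besselOpTwo (α + 2))^[n] (fun t => (t ^ 2)⁻¹ * f t) x := by
  induction n generalizing x with
  | zero => exact (mul_inv_cancel_left₀ (pow_ne_zero 2 hx) (f x)).symm
  | succ n ih =>
    have h : (besselFactor α)^[n] f =ᶠ[𝓝 x]
        fun t => t ^ 2 * (besselOpTwo (α + 2))^[n] (fun s => (s ^ 2)⁻¹ * f s) t :=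
      eventually_of_ne_of_contDiffAt hx hf fun t ht hft => ih ht (hft.of_le (by norm_cast; lia))
    have hL : ContDiffAt ℝ 2 ((besselOpTwo (α + 2))^[n] fun s => (s ^ 2)⁻¹ * f s) x :=
      contDiffAt_besselOpTwo_iterate (n := 2) _ hx <|
        contDiffAt_inv_pow_mul 2 hx (hf.of_le (by norm_cast; lia))
    rw [Function.iterate_succ_apply', Function.iterate_succ_apply',
      (besselFactor_congr α h).eq_of_nhds, besselFactor_sq_mul α hx hL]

theorem besselOpHigher_eq_besselFactor_iterate (α : ℕ) (hx : x ≠ 0)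
    (hf : ContDiffAt ℝ (2 * α + 4 : ℕ) f x) :
    besselOpHigher α f x = (-1) ^ (α + 1) * (besselFactor α)^[α + 2] f x := by
  have hpow : (fun t => t ^ (2 * (α + 2)) * ((t ^ 2)⁻¹ * f t)) =ᶠ[𝓝 x]
      fun t => t ^ (2 * α + 2) * f t := by
    filter_upwards [isOpen_ne.eventually_mem hx] with t ht
    rw [show 2 * (α + 2) = 2 * α + 2 + 2 by lia, pow_add, mul_assoc,
      mul_inv_cancel_left₀ (pow_ne_zero 2 ht)]
  rw [besselFactor_iterate α (α + 2) hx hf,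
    besselOpTwo_iterate_self (α + 2) hx (contDiffAt_inv_pow_mul 2 hx hf),
    (invXDeriv_iterate_congr hpow _).eq_of_nhds, besselOpHigher, mul_assoc]
  rfl

theorem besselOpHigher_const_mul (α : ℕ) (c : ℝ) (f : ℝ → ℝ) (x : ℝ) :
    besselOpHigher α (fun t => c * f t) x = c * besselOpHigher α f x := by
  simp only [besselOpHigher, mul_left_comm _ c, invXDeriv_iterate_const_mul]

theorem besselOpHigher_add (α : ℕ) (hx : x ≠ 0) (hf : ContDiffAt ℝ (2 * α + 4 : ℕ) f x)
    (hg : ContDiffAt ℝ (2 * α + 4 : ℕ) g x) :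
    besselOpHigher α (fun t => f t + g t) x = besselOpHigher α f x + besselOpHigher α g x := by
  simp only [besselOpHigher, mul_add]
  rw [invXDeriv_iterate_add hx (contDiffAt_pow_mul _ hf) (contDiffAt_pow_mul _ hg),
    mul_add]

end HigherOrder

section HypergeometricZeroFOne

/-- The `k`-th term of the series `₀F₁(-; b; z)`, on which its identities are checked. If `b = -n`
with `n : ℕ`, the terms beyond the `n`-th are quotients by zero, hence `0`. -/
noncomputable def hypergeometricTerm (b z : ℝ) (k : ℕ) : ℝ :=
  z ^ k / ((ascPochhammer ℝ k).eval b * (Nat.factorial k : ℝ))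

variable {b : ℝ}

theorem ascPochhammer_succ_eval_left (b : ℝ) (k : ℕ) :
    (ascPochhammer ℝ (k + 1)).eval b = b * (ascPochhammer ℝ k).eval (b + 1) := by
  simp [ascPochhammer_succ_left]

theorem summable_hypergeometricTerm (b z : ℝ) :
    Summable (hypergeometricTerm b z) := by
  have hratio : Tendsto (fun k : ℕ => ‖z / ((b + k) * (k + 1))‖) atTop (𝓝 0) := by
    refine tendsto_zero_iff_norm_tendsto_zero.mp (Tendsto.const_div_atTop ?_ z)
    exact (tendsto_atTop_add_const_left _ b tendsto_natCast_atTop_atTop).atTop_mul_atTop₀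
      (tendsto_atTop_add_const_right _ 1 tendsto_natCast_atTop_atTop)
  refine summable_of_ratio_norm_eventually_le one_half_lt_one ?_
  filter_upwards [hratio.eventually_le_const one_half_pos] with k hk
  have hstep : hypergeometricTerm b z (k + 1) =
      z / ((b + k) * (k + 1)) * hypergeometricTerm b z k := by
    rw [hypergeometricTerm, hypergeometricTerm, ascPochhammer_succ_eval, Nat.factorial_succ,
      div_mul_div_comm, pow_succ']
    push_cast
    ring
  rw [hstep, norm_mul]
  gcongr

theorem hypergeometricZeroFOne_eq_one_add (b z : ℝ) :
    hypergeometricZeroFOne b z = 1 + ∑' k : ℕ, hypergeometricTerm b z (k + 1) := by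
  have h := (summable_hypergeometricTerm b z).tsum_eq_zero_add
  rwa [show hypergeometricTerm b z 0 = 1 by simp [hypergeometricTerm]] at h

theorem hypergeometricZeroFOne_zero (b : ℝ) : hypergeometricZeroFOne b 0 = 1 := by
  rw [hypergeometricZeroFOne, tsum_eq_single 0 fun k hk => by simp [hk]]
  simp

theorem hasDerivAt_hypergeometricTerm (b z : ℝ) (k : ℕ) :
    HasDerivAt (hypergeometricTerm b · (k + 1)) (hypergeometricTerm (b + 1) z k / b) z := by
  refine ((hasDerivAt_pow (k + 1) z).div_const
    ((ascPochhammer ℝ (k + 1)).eval b * (Nat.factorial (k + 1) : ℝ))).congr_deriv ?_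
  rw [hypergeometricTerm, ascPochhammer_succ_eval_left, Nat.factorial_succ, Nat.add_sub_cancel]
  push_cast
  field_simp

theorem hasDerivAt_hypergeometricZeroFOne (b z : ℝ) :
    HasDerivAt (hypergeometricZeroFOne b) (hypergeometricZeroFOne (b + 1) z / b) z := by
  have hbound (k : ℕ) (y : ℝ) (hy : y ∈ Metric.ball (0 : ℝ) (|z| + 1)) :
      ‖hypergeometricTerm (b + 1) y k / b‖ ≤ ‖hypergeometricTerm (b + 1) (|z| + 1) k / b‖ := by
    have hy' : |y| ≤ |(|z| + 1)| := (mem_ball_zero_iff.mp hy).le.trans (le_abs_self _)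
    simp only [hypergeometricTerm, norm_div, norm_pow, Real.norm_eq_abs]
    gcongr
  have hsum : Summable fun k => ‖hypergeometricTerm (b + 1) (|z| + 1) k / b‖ :=
    ((summable_hypergeometricTerm (b + 1) (|z| + 1)).div_const b).norm
  have hz : z ∈ Metric.ball (0 : ℝ) (|z| + 1) := by simp
  have h := hasDerivAt_tsum_of_isPreconnected hsum Metric.isOpen_ball
    (convex_ball _ _).isPreconnected (fun k y _ => hasDerivAt_hypergeometricTerm b y k) hbound hz
    ((summable_nat_add_iff 1).mpr (summable_hypergeometricTerm b z)) hz
  rw [tsum_div_const] at h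
  exact (h.const_add 1).congr_of_eventuallyEq
    (.of_forall fun y => hypergeometricZeroFOne_eq_one_add b y)

theorem contDiff_hypergeometricZeroFOne (b : ℝ) :
    ContDiff ℝ ∞ (hypergeometricZeroFOne b) := by
  refine contDiff_infty.mpr fun n => ?_
  induction n generalizing b with
  | zero =>
    exact contDiff_zero.mpr <| continuous_iff_continuousAt.mpr fun z =>
      (hasDerivAt_hypergeometricZeroFOne b z).continuousAt
  | succ n ih =>
    push_cast
    refine contDiff_succ_iff_deriv.mpr
      ⟨fun z => (hasDerivAt_hypergeometricZeroFOne b z).differentiableAt, by simp, ?_⟩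
    rw [funext fun z => (hasDerivAt_hypergeometricZeroFOne b z).deriv]
    exact (ih (b + 1)).div_const b

theorem add_one_ne_neg_natCast (hb : ∀ k : ℕ, b ≠ -k) (k : ℕ) : b + 1 ≠ -k := fun h =>
  hb (k + 1) (by push_cast; linarith)

theorem ascPochhammer_eval_ne_zero (hb : ∀ k : ℕ, b ≠ -k) (k : ℕ) :
    (ascPochhammer ℝ k).eval b ≠ 0 := by
  rw [Ne, ascPochhammer_eval_eq_zero_iff]
  rintro ⟨j, -, h⟩
  exact hb j (by rw [h, neg_neg])

theorem hypergeometricZeroFOne_contiguous (hb : ∀ k : ℕ, b ≠ -k) (z : ℝ) :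
    hypergeometricZeroFOne b z = hypergeometricZeroFOne (b + 1) z +
      z / (b * (b + 1)) * hypergeometricZeroFOne (b + 2) z := by
  have hb₁ := add_one_ne_neg_natCast hb
  have hb₂ : ∀ k : ℕ, b + 2 ≠ -k := by
    simpa only [add_assoc, one_add_one_eq_two] using add_one_ne_neg_natCast hb₁
  have hterm (k : ℕ) : hypergeometricTerm b z (k + 1) = hypergeometricTerm (b + 1) z (k + 1) +
      z / (b * (b + 1)) * hypergeometricTerm (b + 2) z k := by
    have hb0 : b ≠ 0 := by simpa using hb 0
    have hb10 : b + 1 ≠ 0 := by simpa using hb₁ 0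
    have hP := ascPochhammer_eval_ne_zero hb₂ k
    have hQ := ascPochhammer_eval_ne_zero hb₁ k
    have hshift : (ascPochhammer ℝ k).eval (b + 1) * (b + 1 + k) =
        (b + 1) * (ascPochhammer ℝ k).eval (b + 2) := by
      rw [← ascPochhammer_succ_eval, ascPochhammer_succ_eval_left, add_assoc, one_add_one_eq_two]
    simp only [hypergeometricTerm, ascPochhammer_succ_eval_left, Nat.factorial_succ, add_assoc,
      one_add_one_eq_two]
    push_cast
    field_simp
    linear_combination -z ^ (k + 1) * hshift
  rw [hypergeometricZeroFOne_eq_one_add b, hypergeometricZeroFOne_eq_one_add (b + 1),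
    tsum_congr hterm, Summable.tsum_add, tsum_mul_left, add_assoc]
  · rfl
  · exact (summable_nat_add_iff 1).mpr (summable_hypergeometricTerm _ z)
  · exact (summable_hypergeometricTerm _ z).mul_left _

end HypergeometricZeroFOne

section Bessel

/-- The entire function `(lam x)⁻ⁿ Jₙ(lam x)`, with `Jₙ` the usual Bessel function of the first
kind. In this normalization the recurrence and differentiation formulas have no factorials. -/
noncomputable def reducedBesselJ (n : ℕ) (lam x : ℝ) : ℝ :=
  besselJ n lam x / (2 ^ n * (Nat.factorial n : ℝ))

theorem besselJ_eq_reducedBesselJ (n : ℕ) (lam : ℝ) :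
    besselJ n lam = fun x => 2 ^ n * (Nat.factorial n : ℝ) * reducedBesselJ n lam x := by
  ext x
  rw [reducedBesselJ, mul_div_cancel₀ _ (by positivity)]

theorem besselJ_zero (n : ℕ) (lam : ℝ) : besselJ n lam 0 = 1 := by
  simp [besselJ, hypergeometricZeroFOne_zero]

theorem contDiff_besselJ (n : ℕ) (lam : ℝ) : ContDiff ℝ ∞ (besselJ n lam) :=
  (contDiff_hypergeometricZeroFOne _).comp (by fun_prop)

theorem contDiff_reducedBesselJ (n : ℕ) (lam : ℝ) : ContDiff ℝ ∞ (reducedBesselJ n lam) :=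
  (contDiff_besselJ n lam).div_const _

theorem hasDerivAt_reducedBesselJ (n : ℕ) (lam x : ℝ) :
    HasDerivAt (reducedBesselJ n lam) (x * (-lam ^ 2 * reducedBesselJ (n + 1) lam x)) x := by
  have hinner : HasDerivAt (fun t => -(1 / 4) * (lam * t) ^ 2) (-(lam ^ 2 * x / 2)) x := by
    refine ((((hasDerivAt_id' x).const_mul lam).fun_pow 2).const_mul (-(1 / 4))).congr_deriv ?_
    push_cast
    ring
  refine (((hasDerivAt_hypergeometricZeroFOne ((n : ℝ) + 1) _).comp x hinner).div_const
    (2 ^ n * (Nat.factorial n : ℝ))).congr_deriv ?_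
  rw [reducedBesselJ, besselJ, Nat.factorial_succ, Nat.cast_succ]
  push_cast
  field_simp
  ring

theorem reducedBesselJ_recurrence (n : ℕ) (lam x : ℝ) :
    (lam * x) ^ 2 * reducedBesselJ (n + 2) lam x =
      2 * (n + 1) * reducedBesselJ (n + 1) lam x - reducedBesselJ n lam x := by
  have h := hypergeometricZeroFOne_contiguous (b := (n : ℝ) + 1)
    (fun k => (lt_of_le_of_lt (neg_nonpos.mpr k.cast_nonneg) n.cast_add_one_pos).ne')
    (-(1 / 4) * (lam * x) ^ 2)
  simp only [reducedBesselJ, besselJ, Nat.factorial_succ]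
  push_cast
  rw [h, show (n : ℝ) + 2 + 1 = n + 1 + 2 by ring]
  field_simp
  ring

variable {x : ℝ}

theorem invXDeriv_reducedBesselJ (n : ℕ) (lam : ℝ) (hx : x ≠ 0) :
    invXDeriv (reducedBesselJ n lam) x = -lam ^ 2 * reducedBesselJ (n + 1) lam x := by
  rw [invXDeriv, (hasDerivAt_reducedBesselJ n lam x).deriv, inv_mul_cancel_left₀ hx]

theorem invXDeriv_pow_mul_reducedBesselJ (n : ℕ) (lam : ℝ) (hx : x ≠ 0) :
    invXDeriv (fun t => t ^ (2 * n + 2) * reducedBesselJ (n + 1) lam t) x =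
      x ^ (2 * n) * reducedBesselJ n lam x := by
  rw [invXDeriv_pow_mul n hx (hasDerivAt_reducedBesselJ _ _ _).differentiableAt,
    invXDeriv_reducedBesselJ _ _ hx]
  linear_combination -x ^ (2 * n) * reducedBesselJ_recurrence n lam x

theorem invXDeriv_iterate_reducedBesselJ (n k : ℕ) (lam : ℝ) (hx : x ≠ 0) :
    invXDeriv^[k] (reducedBesselJ n lam) x = (-lam ^ 2) ^ k * reducedBesselJ (n + k) lam x := by
  induction k generalizing n with
  | zero => simp
  | succ k ih =>
    have h : invXDeriv (reducedBesselJ n lam) =ᶠ[𝓝 x]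
        fun t => -lam ^ 2 * reducedBesselJ (n + 1) lam t :=
      (isOpen_ne.eventually_mem hx).mono fun t ht => invXDeriv_reducedBesselJ n lam ht
    rw [Function.iterate_succ_apply, (invXDeriv_iterate_congr h k).eq_of_nhds,
      invXDeriv_iterate_const_mul]
    beta_reduce
    rw [ih, pow_succ' (-lam ^ 2), mul_assoc, add_right_comm, add_assoc]

theorem invXDeriv_iterate_pow_mul_reducedBesselJ (n k : ℕ) (lam : ℝ) (hx : x ≠ 0) :
    invXDeriv^[n + k] (fun t => t ^ (2 * n) * reducedBesselJ n lam t) x =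
      (-lam ^ 2) ^ k * reducedBesselJ k lam x := by
  induction n with
  | zero => simpa using invXDeriv_iterate_reducedBesselJ 0 k lam hx
  | succ n ih =>
    have h : invXDeriv (fun t => t ^ (2 * (n + 1)) * reducedBesselJ (n + 1) lam t) =ᶠ[𝓝 x]
        fun t => t ^ (2 * n) * reducedBesselJ n lam t :=
      (isOpen_ne.eventually_mem hx).mono fun t ht => invXDeriv_pow_mul_reducedBesselJ n lam ht
    rw [add_right_comm, Function.iterate_succ_apply, (invXDeriv_iterate_congr h _).eq_of_nhds, ih]

theorem besselOpTwo_reducedBesselJ (n : ℕ) (lam : ℝ) (hx : x ≠ 0) :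
    besselOpTwo n (reducedBesselJ n lam) x = -lam ^ 2 * reducedBesselJ n lam x := by
  have hδδ := invXDeriv_iterate_reducedBesselJ n 2 lam hx
  simp only [Function.iterate_succ_apply, Function.iterate_zero_apply] at hδδ
  rw [besselOpTwo_eq_invXDeriv n hx (contDiffAt_natCast 2 (contDiff_reducedBesselJ n lam)), hδδ,
    invXDeriv_reducedBesselJ n lam hx]
  linear_combination lam ^ 2 * reducedBesselJ_recurrence n lam x

theorem neg_one_pow_mul_neg_sq_pow (a : ℝ) (k : ℕ) :
    (-1) ^ k * (-a ^ 2) ^ (k + 1) = -a ^ (2 * k + 2) := by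
  rw [pow_succ, ← mul_assoc, ← mul_pow, neg_one_mul, neg_neg]
  ring

theorem besselOpHigher_sq_mul_reducedBesselJ (α : ℕ) (lam : ℝ) (hx : x ≠ 0) :
    besselOpHigher α (fun t => t ^ 2 * reducedBesselJ (α + 2) lam t) x =
      -lam ^ (2 * α + 4) * (x ^ 2 * reducedBesselJ (α + 2) lam x) := by
  have hpow (t : ℝ) : t ^ (2 * α + 2) * (t ^ 2 * reducedBesselJ (α + 2) lam t) =
      t ^ (2 * (α + 2)) * reducedBesselJ (α + 2) lam t := by ring
  have hsign : (-1) ^ (α + 1) * (-lam ^ 2) ^ (α + 2) = -lam ^ (2 * α + 4) :=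
    neg_one_pow_mul_neg_sq_pow lam (α + 1)
  simp only [besselOpHigher, hpow]
  rw [show 2 * α + 4 = α + 2 + (α + 2) by lia,
    invXDeriv_iterate_pow_mul_reducedBesselJ (α + 2) (α + 2) lam hx,
    show α + 2 + (α + 2) = 2 * α + 4 by lia]
  linear_combination x ^ 2 * reducedBesselJ (α + 2) lam x * hsign

theorem besselOpHigher_reducedBesselJ_succ (α : ℕ) (lam : ℝ) (hx : x ≠ 0) :
    besselOpHigher α (reducedBesselJ (α + 1) lam) x =
      lam ^ (2 * α + 6) * (x ^ 2 * reducedBesselJ (α + 3) lam x) := by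
  have hsign : (-1) ^ (α + 1) * (-lam ^ 2) ^ (α + 3) = lam ^ (2 * α + 6) := by
    rw [pow_succ (-lam ^ 2), ← mul_assoc, neg_one_pow_mul_neg_sq_pow lam (α + 1)]
    ring
  rw [besselOpHigher, show 2 * α + 4 = α + 1 + (α + 3) by lia,
    show 2 * α + 2 = 2 * (α + 1) by lia,
    invXDeriv_iterate_pow_mul_reducedBesselJ (α + 1) (α + 3) lam hx]
  linear_combination x ^ 2 * reducedBesselJ (α + 3) lam x * hsign

theorem besselOpHigher_reducedBesselJ (α : ℕ) (lam : ℝ) (hx : x ≠ 0) :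
    besselOpHigher α (reducedBesselJ α lam) x = lam ^ (2 * α + 4) *
      (4 * (α + 1) * (α + 2) * reducedBesselJ (α + 2) lam x - reducedBesselJ α lam x) := by
  have hsplit : reducedBesselJ α lam = fun t => 2 * ((α : ℝ) + 1) * reducedBesselJ (α + 1) lam t +
      -lam ^ 2 * (t ^ 2 * reducedBesselJ (α + 2) lam t) := by
    ext t
    linear_combination reducedBesselJ_recurrence α lam t
  have hsmooth (n : ℕ) : ContDiffAt ℝ (2 * α + 4 : ℕ) (reducedBesselJ n lam) x :=
    contDiffAt_natCast _ (contDiff_reducedBesselJ n lam)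
  have hrec := reducedBesselJ_recurrence (α + 1) lam x
  push_cast at hrec
  conv_lhs => rw [hsplit]
  rw [besselOpHigher_add α hx (contDiffAt_const.mul (hsmooth _))
    (contDiffAt_const.mul (contDiffAt_pow_mul 2 (hsmooth _))), besselOpHigher_const_mul,
    besselOpHigher_const_mul, besselOpHigher_reducedBesselJ_succ α lam hx,
    besselOpHigher_sq_mul_reducedBesselJ α lam hx]
  linear_combination lam ^ (2 * α + 4) *
    (2 * (α + 1) * hrec + reducedBesselJ_recurrence α lam x)

theorem besselOpTwo_besselJ (n : ℕ) (lam : ℝ) (hx : x ≠ 0) :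
    besselOpTwo n (besselJ n lam) x = -lam ^ 2 * besselJ n lam x := by
  simp only [besselJ_eq_reducedBesselJ, besselOpTwo_const_mul, besselOpTwo_reducedBesselJ n lam hx]
  ring

theorem besselOpHigher_besselJ (α : ℕ) (lam : ℝ) (hx : x ≠ 0) :
    besselOpHigher α (besselJ α lam) x =
      lam ^ (2 * α + 4) * (besselJ (α + 2) lam x - besselJ α lam x) := by
  simp only [besselJ_eq_reducedBesselJ, besselOpHigher_const_mul,
    besselOpHigher_reducedBesselJ α lam hx, Nat.factorial_succ]
  push_cast
  ring

theorem besselTypeJ_eq (α : ℕ) (M lam : ℝ) :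
    besselTypeJ α M lam = fun x => besselJ α lam x + M * besselK α lam x :=
  rfl

theorem besselK_eq (α : ℕ) (lam : ℝ) :
    besselK α lam = fun x => -besselCoeff α lam * (2 ^ (α + 2) * (Nat.factorial (α + 2) : ℝ)) *
      (x ^ 2 * reducedBesselJ (α + 2) lam x) := by
  ext x
  rw [besselK, besselJ_eq_reducedBesselJ]
  ring

theorem contDiff_besselK (α : ℕ) (lam : ℝ) : ContDiff ℝ ∞ (besselK α lam) :=
  (contDiff_const.mul (contDiff_id.pow 2)).mul (contDiff_besselJ (α + 2) lam)

theorem contDiff_besselTypeJ (α : ℕ) (M lam : ℝ) : ContDiff ℝ ∞ (besselTypeJ α M lam) :=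
  (contDiff_besselJ α lam).add (contDiff_const.mul (contDiff_besselK α lam))

theorem besselOpTwo_besselK (α : ℕ) (lam : ℝ) (hx : x ≠ 0) :
    besselOpTwo α (besselK α lam) x = -lam ^ 2 * besselK α lam x -
      lam ^ (2 * α + 4) / (2 ^ (2 * α + 2) * (Nat.factorial (α + 2) : ℝ)) *
        besselJ (α + 2) lam x := by
  simp only [besselK_eq, besselOpTwo_const_mul]
  rw [besselOpTwo_sq_mul α hx (contDiffAt_natCast 2 (contDiff_reducedBesselJ _ _)),
    besselOpTwo_reducedBesselJ (α + 2) lam hx, besselJ_eq_reducedBesselJ, besselCoeff, div_pow]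
  field_simp
  ring

theorem besselOpHigher_besselK (α : ℕ) (lam : ℝ) (hx : x ≠ 0) :
    besselOpHigher α (besselK α lam) x = -lam ^ (2 * α + 4) * besselK α lam x := by
  simp only [besselK_eq, besselOpHigher_const_mul, besselOpHigher_sq_mul_reducedBesselJ α lam hx]
  ring

theorem exists_pos_besselK_ne_zero (α : ℕ) {lam : ℝ} (hlam : lam ≠ 0) :
    ∃ x, 0 < x ∧ besselK α lam x ≠ 0 := by
  have hJ : ∀ᶠ x in 𝓝 0, besselJ (α + 2) lam x ≠ 0 :=
    (contDiff_besselJ (α + 2) lam).continuous.continuousAt.eventually_ne (by simp [besselJ_zero])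
  obtain ⟨x, hJx, hx⟩ :=
    ((hJ.filter_mono nhdsWithin_le_nhds).and (self_mem_nhdsWithin (s := Ioi 0))).exists
  have hcoeff : besselCoeff α lam ≠ 0 := by
    rw [besselCoeff]
    positivity
  exact ⟨x, hx, mul_ne_zero (mul_ne_zero (neg_ne_zero.mpr hcoeff) (pow_ne_zero 2 hx.ne')) hJx⟩

theorem besselOpTwo_besselTypeJ (α : ℕ) (M lam : ℝ) (hx : x ≠ 0) :
    besselOpTwo α (besselTypeJ α M lam) x = -lam ^ 2 * besselTypeJ α M lam x -
      M / (2 ^ (2 * α + 2) * (Nat.factorial (α + 2) : ℝ)) *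
        (lam ^ (2 * α + 4) * besselJ (α + 2) lam x) := by
  rw [besselTypeJ_eq, besselOpTwo_add α hx (contDiffAt_natCast 2 (contDiff_besselJ α lam))
    (contDiffAt_natCast 2 (contDiff_const.mul (contDiff_besselK α lam))),
    besselOpTwo_const_mul, besselOpTwo_besselJ α lam hx, besselOpTwo_besselK α lam hx]
  ring

theorem besselOpHigher_besselTypeJ (α : ℕ) (M lam : ℝ) (hx : x ≠ 0) :
    besselOpHigher α (besselTypeJ α M lam) x = -lam ^ (2 * α + 4) * besselTypeJ α M lam x +
      lam ^ (2 * α + 4) * besselJ (α + 2) lam x := by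
  rw [besselTypeJ_eq, besselOpHigher_add α hx (contDiffAt_natCast _ (contDiff_besselJ α lam))
    (contDiffAt_natCast _ (contDiff_const.mul (contDiff_besselK α lam))),
    besselOpHigher_const_mul, besselOpHigher_besselJ α lam hx, besselOpHigher_besselK α lam hx]
  ring

end Bessel

theorem tendsto_nhdsNE_of_eq {f g : ℝ → ℝ} {a : ℝ} (hg : Continuous g) (h : ∀ x ≠ a, f x = g x) :
    Tendsto f (𝓝[≠] a) (𝓝 (g a)) :=
  tendsto_nhdsWithin_congr (fun x hx => (h x hx).symm) hg.continuousWithinAt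

theorem theorem5p1_general (α : ℕ) :
    (∀ y : ℝ → ℝ, ∀ x ≠ 0, ContDiffAt ℝ 2 y x →
      besselOpTwo α y x = deriv (deriv y) x + (2 * α + 1) / x * deriv y x) ∧
    (∀ y : ℝ → ℝ, ∀ x ≠ 0, ContDiffAt ℝ (2 * α + 4 : ℕ) y x →
      besselOpHigher α y x = (-1) ^ (α + 1) * (besselFactor α)^[α + 2] y x) ∧
    (∀ M lam : ℝ,
      ContDiff ℝ ∞ (besselTypeJ α M lam) ∧
      (∀ x ≠ 0,
        (besselOpTwo α (besselTypeJ α M lam) x + lam ^ 2 * besselTypeJ α M lam x) +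
          M / (2 ^ (2 * α + 2) * (Nat.factorial (α + 2) : ℝ)) *
            (besselOpHigher α (besselTypeJ α M lam) x +
              lam ^ (2 * α + 4) * besselTypeJ α M lam x) = 0) ∧
      (∃ u v : ℝ,
        Tendsto (besselOpTwo α (besselTypeJ α M lam)) (𝓝[≠] 0) (𝓝 u) ∧
        Tendsto (besselOpHigher α (besselTypeJ α M lam)) (𝓝[≠] 0) (𝓝 v) ∧
        (u + lam ^ 2 * besselTypeJ α M lam 0) +
          M / (2 ^ (2 * α + 2) * (Nat.factorial (α + 2) : ℝ)) *
            (v + lam ^ (2 * α + 4) * besselTypeJ α M lam 0) = 0)) ∧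
    (∀ lam : ℝ,
      ContDiff ℝ ∞ (besselK α lam) ∧
      (lam ≠ 0 → ∃ x : ℝ, 0 < x ∧ besselK α lam x ≠ 0) ∧
      (∀ x ≠ 0, besselOpHigher α (besselK α lam) x + lam ^ (2 * α + 4) * besselK α lam x = 0) ∧
      (∃ v : ℝ,
        Tendsto (besselOpHigher α (besselK α lam)) (𝓝[≠] 0) (𝓝 v) ∧
        v + lam ^ (2 * α + 4) * besselK α lam 0 = 0)) := by
  refine ⟨fun y x hx hy => besselOpTwo_eq_deriv α hx hy,
    fun y x hx hy => besselOpHigher_eq_besselFactor_iterate α hx hy,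
    fun M lam => ⟨contDiff_besselTypeJ α M lam, fun x hx => ?_, ?_⟩,
    fun lam => ⟨contDiff_besselK α lam, exists_pos_besselK_ne_zero α, fun x hx => ?_, ?_⟩⟩
  · rw [besselOpTwo_besselTypeJ α M lam hx, besselOpHigher_besselTypeJ α M lam hx]
    ring
  · have hJ := (contDiff_besselJ (α + 2) lam).continuous
    have hy := (contDiff_besselTypeJ α M lam).continuous
    refine ⟨_, _, tendsto_nhdsNE_of_eq ?_ fun x => besselOpTwo_besselTypeJ α M lam,
      tendsto_nhdsNE_of_eq ?_ fun x => besselOpHigher_besselTypeJ α M lam, by ring⟩ <;> fun_prop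
  · rw [besselOpHigher_besselK α lam hx]
    ring
  · have hK := (contDiff_besselK α lam).continuous
    exact ⟨_, tendsto_nhdsNE_of_eq (by fun_prop) fun x => besselOpHigher_besselK α lam, by ring⟩

theorem theorem5p1 (α : ℕ) :
    -- the representations of the two operators on sufficiently smooth functions
    (∀ y : ℝ → ℝ, ContDiffOn ℝ 2 y (Ioi 0) → ∀ x : ℝ, 0 < x →
      besselOpTwo α y x = deriv (deriv y) x + (2 * (α : ℝ) + 1) / x * deriv y x) ∧
    (∀ y : ℝ → ℝ, ContDiffOn ℝ ((2 * α + 4 : ℕ) : ℕ∞) y (Ioi 0) → ∀ x : ℝ, 0 < x →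
      besselOpHigher α y x = (-1) ^ (α + 1) * ((besselFactor α)^[α + 2] y) x) ∧
    -- the Bessel-type functions solve the combined equation on `[0, ∞)`;
    -- at `x = 0` the two differential expressions are understood as limits from the right
    (∀ M lam : ℝ, 0 ≤ M → 0 ≤ lam →
      ContDiffOn ℝ ∞ (besselTypeJ α M lam) (Ici 0) ∧
      (∀ x : ℝ, 0 < x →
        (besselOpTwo α (besselTypeJ α M lam) x + lam ^ 2 * besselTypeJ α M lam x) +
          M / (2 ^ (2 * α + 2) * (Nat.factorial (α + 2) : ℝ)) *
            (besselOpHigher α (besselTypeJ α M lam) x +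
              lam ^ (2 * α + 4) * besselTypeJ α M lam x) = 0) ∧
      (∃ u v : ℝ,
        Tendsto (besselOpTwo α (besselTypeJ α M lam)) (𝓝[>] 0) (𝓝 u) ∧
        Tendsto (besselOpHigher α (besselTypeJ α M lam)) (𝓝[>] 0) (𝓝 v) ∧
        (u + lam ^ 2 * besselTypeJ α M lam 0) +
          M / (2 ^ (2 * α + 2) * (Nat.factorial (α + 2) : ℝ)) *
            (v + lam ^ (2 * α + 4) * besselTypeJ α M lam 0) = 0)) ∧
    -- the second component is an eigenfunction of the higher-order operator on `[0, ∞)`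
    (∀ lam : ℝ, 0 ≤ lam →
      ContDiffOn ℝ ∞ (besselK α lam) (Ici 0) ∧
      (0 < lam → ∃ x : ℝ, 0 < x ∧ besselK α lam x ≠ 0) ∧
      (∀ x : ℝ, 0 < x →
        besselOpHigher α (besselK α lam) x + lam ^ (2 * α + 4) * besselK α lam x = 0) ∧
      (∃ v : ℝ,
        Tendsto (besselOpHigher α (besselK α lam)) (𝓝[>] 0) (𝓝 v) ∧
        v + lam ^ (2 * α + 4) * besselK α lam 0 = 0)) := by
  obtain ⟨hL2, hLh, hJ, hK⟩ := theorem5p1_general α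
  refine ⟨fun y hy x hx => hL2 y x hx.ne' (hy.contDiffAt (Ioi_mem_nhds hx)),
    fun y hy x hx => hLh y x hx.ne' (hy.contDiffAt (Ioi_mem_nhds hx)),
    fun M lam _ _ => ?_, fun lam _ => ?_⟩
  · obtain ⟨hsmooth, heq, u, v, hu, hv, huv⟩ := hJ M lam
    exact ⟨hsmooth.contDiffOn, fun x hx => heq x hx.ne', u, v,
      hu.mono_left (nhdsGT_le_nhdsNE 0), hv.mono_left (nhdsGT_le_nhdsNE 0), huv⟩
  · obtain ⟨hsmooth, hne, heq, v, hv, hv0⟩ := hK lam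
    exact ⟨hsmooth.contDiffOn, fun hlam => hne hlam.ne', fun x hx => heq x hx.ne', v,
      hv.mono_left (nhdsGT_le_nhdsNE 0), hv0⟩
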